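/- Let $k$ be an algebraically closed field of characteristic $0$, and let $(R,\mathfrak m)$ be a complete local noetherian domain of dimension $1$ containing $k$ with $R/\mathfrak m=k$ and with normalization $\overline R=k[[t]]$, so that $k\subseteq R\subseteq k[[t]]$ and $Q(R)=k((t))$. Let $v$ be the $t$-adic valuation, $v(I)=\{v(f): 0\ne f\in I\}$ for an ideal $I$, and $V(R)=v(R)$. The Herzog--Kunz sequence of a local $k$-subalgebra $A\subseteq k[[t]]$ with maximal ideal $\mathfrak m_A$ is the set $v(\mathfrak m_A)\setminus v(\mathfrak m_A^2)$ written in increasing order, and elements of $A$ having the members of the sequence as their values are called Herzog--Kunz generators of $A$. Let $a_1<\dots<a_n$ be the Herzog--Kunz sequence of $R$ and let $x_1,\dots,x_n\in R$ be Herzog--Kunz generators, $v(x_i)=a_i$. Let $\mathfrak C_R=\{f\in R: f\,\overline R\subseteq R\}=t^{c_R}\overline R$ be the conductor ideal, with conductor degree $c_R$, and assume $\mathfrak C_R\subseteq\mathfrak m^2$. Put $S=R[\mathfrak C_R/x_1]\subseteq k[[t]]$, let $i_0=\max\{i: a_i<c_R-a_1\}$ (with $i_0=0$ if there is no such $i$),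 and let $b_1<\dots<b_s$ be the integers in $[c_R-a_1,\,c_R-1]$ that do not belong to $V(R)$. Then $s=\dim_k\big((\mathfrak C_R,x_1)/(x_1)\big)$, the ring $S$ is local, its Herzog--Kunz sequence has exactly $n+s$ members $\widetilde a_1<\dots<\widetilde a_{n+s}$, and $$\{\widetilde a_{i_0+1},\dots,\widetilde a_{n+s}\}=\{a_{i_0+1},\dots,a_n,b_1,\dots,b_s\}.$$ Moreover $S=k[[\widetilde x_1,\dots,\widetilde x_{n+s}]]$ for Herzog--Kunz generators $\widetilde x_1,\dots,\widetilde x_{n+s}$ of $S$ (that is, $\widetilde x_j\in S$ and $v(\widetilde x_j)=\widetilde a_j$) such that $\widetilde x_j=x_j$ for $j\le i_0$ and $\widetilde x_j=t^{\widetilde a_j}$ for $j>i_0$. -/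

import Mathlib

open scoped PowerSeries LaurentSeries

noncomputable section

namespace HerzogKunz

variable {k : Type*} [Field k]

/-- The set `v(I)` of `t`-adic values of the nonzero elements of an ideal `I` of a subalgebra `A`
of `k⟦t⟧` (the order of `0` is `⊤`, so that `0` contributes nothing). -/
def valueSet {A : Subalgebra k k⟦X⟧} (I : Ideal A) : Set ℕ :=
  {w | ∃ f ∈ I, (f : k⟦X⟧).order = w}

/-- The valuation semigroup `V(A)`. -/
def valueSemigroup (A : Subalgebra k k⟦X⟧) : Set ℕ :=
  valueSet (⊤ : Ideal A)

/-- `a` lists, in increasing order, the set `v(𝔪) \ v(𝔪²)`. -/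
def IsHKSequence (A : Subalgebra k k⟦X⟧) [IsLocalRing A] {n : ℕ} (a : Fin n → ℕ) : Prop :=
  StrictMono a ∧ Set.range a =
    valueSet (IsLocalRing.maximalIdeal A) \ valueSet (IsLocalRing.maximalIdeal A ^ 2)

/-- `x₁, …, xₙ ∈ A` are Herzog--Kunz generators belonging to the sequence `a`: `v(xᵢ) = aᵢ`. -/
def IsHKGenerators {A : Subalgebra k k⟦X⟧} {n : ℕ} (a : Fin n → ℕ) (x : Fin n → A) : Prop :=
  ∀ i, (x i : k⟦X⟧).order = a i

/-- `A = k⟦x₁, …, xₙ⟧`: power series in `n` variables can be evaluated at the `xᵢ`, and `A` is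
exactly the set of the values. -/
def IsParametrization (A : Subalgebra k k⟦X⟧) {n : ℕ} (x : Fin n → A) : Prop :=
  MvPowerSeries.HasSubst (fun i => ((x i : k⟦X⟧) : MvPowerSeries Unit k)) ∧
  ∀ f : k⟦X⟧, f ∈ A ↔
    ∃ F : MvPowerSeries (Fin n) k,
      MvPowerSeries.subst (fun i => ((x i : k⟦X⟧) : MvPowerSeries Unit k)) F = f

/-- The conductor ideal `{f ∈ R | f · k⟦t⟧ ⊆ R}` of `R` in `k⟦t⟧`. -/
def conductorIdeal (R : Subalgebra k k⟦X⟧) : Ideal R where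
  carrier := {f | ∀ g : k⟦X⟧, (f : k⟦X⟧) * g ∈ R}
  zero_mem' := fun g => by simp
  add_mem' := fun {f f'} hf hf' g => by
    have h : ((f + f' : R) : k⟦X⟧) * g = f * g + f' * g := by simp [add_mul]
    rw [h]
    exact R.add_mem (hf g) (hf' g)
  smul_mem' := fun r f hf g => by
    have h : ((r • f : R) : k⟦X⟧) * g = r * (f * g) := by simp [mul_assoc]
    rw [h]
    exact R.mul_mem r.2 (hf g)

/-- The conductor degree: the least value of an element of the conductor ideal, that is, the
exponent `c` such that the conductor ideal is `t ^ c · k⟦t⟧`. -/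
def conductorDegree (R : Subalgebra k k⟦X⟧) : ℕ :=
  sInf (valueSet (conductorIdeal R))

/-- The ring `R[𝔠 / y]`, where `𝔠` is the conductor ideal of `R`. The quotient `h / y` is the
`g ∈ k⟦t⟧` with `y * g = h`; it exists in `k⟦t⟧` as soon as `v(y) ≤ v(h)`, see
`exists_mul_eq_of_order_le`. -/
def conductorExtension (R : Subalgebra k k⟦X⟧) (y : R) : Subalgebra k k⟦X⟧ :=
  (Algebra.adjoin R {g : k⟦X⟧ | ∃ h ∈ conductorIdeal R, (y : k⟦X⟧) * g = h}).restrictScalars k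

theorem exists_mul_eq_of_order_le {y h : k⟦X⟧} (hy : y ≠ 0) (hyh : y.order ≤ h.order) :
    ∃ g : k⟦X⟧, y * g = h := by
  obtain ⟨n, hn⟩ := ENat.ne_top_iff_exists.mp (mt PowerSeries.order_eq_top.mp hy)
  obtain ⟨u, hu⟩ := PowerSeries.X_pow_order_dvd (φ := y)
  have hnn : y.order.toNat = n := by rw [← hn]; rfl
  rw [hnn] at hu
  have hu0 : PowerSeries.constantCoeff u ≠ 0 := by
    have h1 : PowerSeries.coeff n y ≠ 0 := by
      have := PowerSeries.coeff_order hy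
      rwa [hnn] at this
    rw [hu] at h1
    simpa [PowerSeries.coeff_X_pow_mul'] using h1
  have hX : (PowerSeries.X : k⟦X⟧) ^ n ∣ h := by
    rw [PowerSeries.X_pow_dvd_iff]
    intro m hm
    apply PowerSeries.coeff_of_lt_order
    refine lt_of_lt_of_le ?_ hyh
    rw [← hn]
    exact_mod_cast hm
  obtain ⟨w, hw⟩ := hX
  refine ⟨u⁻¹ * w, ?_⟩
  rw [hu, hw, mul_assoc, ← mul_assoc u, PowerSeries.mul_inv_cancel u hu0, one_mul]

/-- The reduced type `dim_k ((𝔠, y) / (y))`: the `k`-dimension of the image of the conductor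
ideal `𝔠` in `R / (y)`. -/
def reducedType (R : Subalgebra k k⟦X⟧) (y : R) : ℕ :=
  Module.finrank k ((conductorIdeal R).map (Ideal.Quotient.mk (Ideal.span {y})))

/-- The largest `i ∈ {1, …, n}` with `aᵢ < c - a₁`, and `0` if there is none. The sequence
`a₁, …, aₙ` is indexed by `Fin n`, so `aᵢ` has the index `i - 1`. -/
def lastIndexBelow {n : ℕ} (a : Fin n → ℕ) (hn : 0 < n) (c : ℕ) : ℕ :=
  (Finset.univ.filter fun i : Fin n => a i + a ⟨0, hn⟩ < c).sup fun i => (i : ℕ) + 1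

end HerzogKunz

end

open scoped PowerSeries LaurentSeries

noncomputable section

namespace HerzogKunz

variable {k : Type*} [Field k]

section

open PowerSeries Finset

/-! Write e = a₁ and c = e + d. Dividing the conductor t^c k⟦t⟧ by x₁ gives t^d k⟦t⟧, an ideal of
k⟦t⟧, so S = R + t^d k⟦t⟧ (`mem_conductorExtension_iff`). Since t^c lies in 𝔪², whose elements have
value at least 2e, one gets e ≤ d. Hence 𝔪_S² differs from 𝔪² only by elements of t^c k⟦t⟧ ⊆ 𝔪², and
the two squares coincide (`idealSubspace_maximalIdeal_sq_eq`). The sequence of S is therefore that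
of R together with the new values of 𝔪_S, which are exactly the gaps in [d, c)
(`valueSet_maximalIdeal_sdiff_eq`).

Multiplication by x₁ identifies the image of the conductor in R/(x₁) with t^d k⟦t⟧ / (R ∩ t^d k⟦t⟧),
which has the classes of the t^{bᵢ} as a basis (`reducedType_eq`).

Herzog–Kunz generators span the maximal ideal modulo its square, so their power series are
t-adically dense in S. A dense subalgebra has elements of all values ≥ c, and t^c k⟦t⟧ is generated
over k⟦x̃₁⟧ by finitely many of them; this turns density into equality
(`isParametrization_of_isHKGenerators`). -/

/-! ### Values as divisibility by powers of t -/

theorem le_order_iff_X_pow_dvd {f : k⟦X⟧} {m : ℕ} : (m : ℕ∞) ≤ f.order ↔ (X : k⟦X⟧) ^ m ∣ f := by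
  rw [X_pow_dvd_iff]
  refine ⟨fun h i hi => coeff_of_lt_order _ (lt_of_lt_of_le (by exact_mod_cast hi) h),
    fun h => nat_le_order _ _ h⟩

theorem X_pow_dvd_of_order {f : k⟦X⟧} {m : ℕ} (h : f.order = m) : (X : k⟦X⟧) ^ m ∣ f :=
  le_order_iff_X_pow_dvd.1 h.ge

theorem order_eq_of_dvd {f : k⟦X⟧} {m : ℕ} (h : (X : k⟦X⟧) ^ m ∣ f) (h0 : coeff m f ≠ 0) :
    f.order = m :=
  order_eq_nat.2 ⟨h0, X_pow_dvd_iff.1 h⟩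

theorem X_pow_succ_dvd {f : k⟦X⟧} {m : ℕ} (h : (X : k⟦X⟧) ^ m ∣ f) (h0 : coeff m f = 0) :
    (X : k⟦X⟧) ^ (m + 1) ∣ f := by
  rw [X_pow_dvd_iff] at h ⊢
  intro i hi
  rcases Nat.lt_succ_iff_lt_or_eq.1 hi with hi | rfl
  exacts [h i hi, h0]

theorem coeff_ne_zero_of_order {f : k⟦X⟧} {m : ℕ} (h : f.order = m) : coeff m f ≠ 0 :=
  (order_eq_nat.1 h).1

theorem ne_zero_of_order {f : k⟦X⟧} {m : ℕ} (h : f.order = m) : f ≠ 0 := by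
  rintro rfl
  simp at h

theorem exists_order_eq {f : k⟦X⟧} (h : f ≠ 0) : ∃ m : ℕ, f.order = m :=
  ⟨_, (ENat.natCast_toNat (order_eq_top.not.2 h)).symm⟩

/-- The leading term of `f` can be cancelled by a multiple of any `g` of the same value. -/
theorem X_pow_succ_dvd_sub {f g : k⟦X⟧} {m : ℕ} (hf : (X : k⟦X⟧) ^ m ∣ f) (hg : g.order = m) :
    (X : k⟦X⟧) ^ (m + 1) ∣ f - (coeff m f / coeff m g) • g := by
  refine X_pow_succ_dvd ?_ ?_
  · exact dvd_sub hf (dvd_smul_of_dvd _ (X_pow_dvd_of_order hg))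
  · simp [div_mul_cancel₀ _ (coeff_ne_zero_of_order hg)]

theorem exists_mul_eq_of_X_pow_dvd {y h : k⟦X⟧} {e : ℕ} (hy : y.order = e)
    (hh : (X : k⟦X⟧) ^ e ∣ h) : ∃ g, y * g = h :=
  exists_mul_eq_of_order_le (ne_zero_of_order hy) (hy ▸ le_order_iff_X_pow_dvd.2 hh)

theorem X_pow_dvd_mul_iff {y g : k⟦X⟧} {e m : ℕ} (hy : y.order = e) :
    (X : k⟦X⟧) ^ (e + m) ∣ y * g ↔ (X : k⟦X⟧) ^ m ∣ g := by
  rw [← le_order_iff_X_pow_dvd, ← le_order_iff_X_pow_dvd, order_mul, hy, Nat.cast_add]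
  exact ENat.add_le_add_iff_left (ENat.natCast_ne_top e)

theorem eq_of_forall_X_pow_dvd {f g : k⟦X⟧} (h : ∀ m, (X : k⟦X⟧) ^ m ∣ f - g) : f = g := by
  ext m
  have := X_pow_dvd_iff.1 (h (m + 1)) m (by omega)
  rwa [map_sub, sub_eq_zero] at this

/-! ### Cancellation of leading terms and expansions -/

/-- A subspace which realizes all values below `c` of `U` and contains the elements of `U` of
value at least `c` contains `U`. -/
theorem submodule_le_of_values {U W : Submodule k k⟦X⟧} (c : ℕ)
    (hc : ∀ f ∈ U, (X : k⟦X⟧) ^ c ∣ f → f ∈ W)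
    (h : ∀ f ∈ U, ∀ w < c, f.order = w → ∃ g ∈ W, g ∈ U ∧ g.order = w) : U ≤ W := by
  suffices H : ∀ j ≤ c, ∀ f ∈ U, (X : k⟦X⟧) ^ (c - j) ∣ f → f ∈ W from
    fun f hf => H c le_rfl f hf (by simp)
  intro j
  induction j with
  | zero => exact fun _ f hf hd => hc f hf hd
  | succ j ih =>
    intro hj f hf hd
    have hw : c - j = c - (j + 1) + 1 := by omega
    by_cases h0 : coeff (c - (j + 1)) f = 0
    · exact ih (by omega) f hf (hw ▸ X_pow_succ_dvd hd h0)
    · obtain ⟨g, hgW, hgU, hg⟩ := h f hf (c - (j + 1)) (by omega) (order_eq_of_dvd hd h0)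
      have := ih (by omega) _ (U.sub_mem hf (U.smul_mem _ hgU)) (hw ▸ X_pow_succ_dvd_sub hd hg)
      have h2 := W.add_mem this (W.smul_mem (coeff (c - (j + 1)) f / coeff (c - (j + 1)) g) hgW)
      rwa [sub_add_cancel] at h2

/-- Leading terms are cancelled one at a time. Convergence is expressed by divisibility of the
remainders, so no topology is involved. -/
theorem exists_coeff_expansion (h : ℕ → k⟦X⟧) {N : ℕ} (hh : ∀ m, (h m).order = (N + m : ℕ))
    {f : k⟦X⟧} (hf : (X : k⟦X⟧) ^ N ∣ f) :
    ∃ δ : ℕ → k, ∀ M, (X : k⟦X⟧) ^ (N + M) ∣ f - ∑ m ∈ range M, δ m • h m := by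
  let F : ℕ → k⟦X⟧ := fun M => Nat.rec f
    (fun M φ => φ - (coeff (N + M) φ / coeff (N + M) (h M)) • h M) M
  let δ : ℕ → k := fun M => coeff (N + M) (F M) / coeff (N + M) (h M)
  have hF : ∀ M, F (M + 1) = F M - δ M • h M := fun M => rfl
  refine ⟨δ, fun M => ?_⟩
  have h1 : F M = f - ∑ m ∈ range M, δ m • h m := by
    induction M with
    | zero => simp [F]
    | succ M ih => rw [hF, ih, sum_range_succ, sub_add_eq_sub_sub]
  rw [← h1]
  clear h1
  induction M with
  | zero => exact hf
  | succ M ih => exact hF M ▸ X_pow_succ_dvd_sub ih (hh M)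

/-- If `v(y) = e` and `v(g r) = N + r` for `r < e`, then every `f ∈ t ^ N k⟦t⟧` is a combination of
the `g r` whose coefficients are power series in `y`. -/
theorem exists_expansion {y : k⟦X⟧} {e N : ℕ} (he : 0 < e) (hy : y.order = e) (g : ℕ → k⟦X⟧)
    (hg : ∀ r < e, (g r).order = (N + r : ℕ)) {f : k⟦X⟧} (hf : (X : k⟦X⟧) ^ N ∣ f) :
    ∃ γ : ℕ → ℕ → k, ∀ L : ℕ → k⟦X⟧,
      (∀ r Q, (X : k⟦X⟧) ^ Q ∣ L r - ∑ q ∈ range Q, γ r q • y ^ q) →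
      f = ∑ r ∈ range e, L r * g r := by
  -- Writing m = q e + r, the product y^q * g r has value N + m: one element for every value ≥ N.
  let h : ℕ → k⟦X⟧ := fun m => y ^ (m / e) * g (m % e)
  have hh : ∀ m, (h m).order = (N + m : ℕ) := by
    intro m
    rw [order_mul, order_pow, hy, hg _ (Nat.mod_lt _ he), nsmul_eq_mul, ← Nat.cast_mul,
      ← Nat.cast_add]
    congr 1
    have := Nat.div_add_mod m e
    rw [mul_comm] at this
    omega
  obtain ⟨δ, hδ⟩ := exists_coeff_expansion h hh hf
  have hblock : ∀ Q, ∑ m ∈ range (Q * e), δ m • h m =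
      ∑ r ∈ range e, (∑ q ∈ range Q, δ (q * e + r) • y ^ q) * g r := by
    intro Q
    induction Q with
    | zero => simp
    | succ Q ih =>
      rw [Nat.succ_mul, sum_range_add, ih, ← sum_add_distrib]
      refine sum_congr rfl fun r hr => ?_
      have hr' := mem_range.1 hr
      have h1 : (Q * e + r) / e = Q := by
        rw [mul_comm, Nat.mul_add_div he, Nat.div_eq_of_lt hr', add_zero]
      have h2 : (Q * e + r) % e = r := by
        rw [mul_comm, Nat.mul_add_mod, Nat.mod_eq_of_lt hr']
      rw [sum_range_succ, add_mul]
      simp only [h, h1, h2, smul_mul_assoc]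
  -- The scalars are fixed before the sums `L r`, so these may be taken in any ring where such
  -- series have a limit.
  refine ⟨fun r q => δ (q * e + r), fun L hL => eq_of_forall_X_pow_dvd fun Q => ?_⟩
  have h1 : (X : k⟦X⟧) ^ Q ∣ f - ∑ m ∈ range (Q * e), δ m • h m :=
    (pow_dvd_pow _ (by nlinarith)).trans (hδ _)
  have h2 : (X : k⟦X⟧) ^ Q ∣
      ∑ r ∈ range e, (L r - ∑ q ∈ range Q, δ (q * e + r) • y ^ q) * g r :=
    dvd_sum fun r _ => (hL r Q).mul_right _
  have h3 := dvd_sub h1 h2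
  rw [hblock] at h3
  simp only [sub_mul, sum_sub_distrib] at h3
  simpa using h3

/-! ### Local subalgebras of k⟦t⟧ -/

/-- Closure under these inverses is the working form of "local with maximal ideal A ∩ t k⟦t⟧"; it
passes from R to S. -/
theorem isUnit_iff_of_inv_mem {A : Subalgebra k k⟦X⟧}
    (hA : ∀ f ∈ A, constantCoeff f ≠ 0 → f⁻¹ ∈ A) (f : A) :
    IsUnit f ↔ constantCoeff (f : k⟦X⟧) ≠ 0 := by
  refine ⟨fun h => ?_, fun h => ?_⟩
  · exact ((h.map A.val).map (constantCoeff (R := k))).ne_zero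
  · exact IsUnit.of_mul_eq_one ⟨_, hA f f.2 h⟩ (Subtype.ext (PowerSeries.mul_inv_cancel _ h))

theorem isLocalRing_of_inv_mem {A : Subalgebra k k⟦X⟧}
    (hA : ∀ f ∈ A, constantCoeff f ≠ 0 → f⁻¹ ∈ A) : IsLocalRing A := by
  refine IsLocalRing.of_nonunits_add fun f g hf hg => ?_
  simp only [mem_nonunits_iff, isUnit_iff_of_inv_mem hA, not_not] at hf hg ⊢
  simp [hf, hg]

theorem mem_maximalIdeal_iff {A : Subalgebra k k⟦X⟧} [IsLocalRing A]
    (hA : ∀ f ∈ A, constantCoeff f ≠ 0 → f⁻¹ ∈ A) (f : A) :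
    f ∈ IsLocalRing.maximalIdeal A ↔ constantCoeff (f : k⟦X⟧) = 0 := by
  rw [IsLocalRing.mem_maximalIdeal, mem_nonunits_iff, isUnit_iff_of_inv_mem hA, not_not]

/-- k⟦t⟧ is integral over R, and an integral extension reflects units. -/
theorem inv_mem_of_isIntegralClosure (R : Subalgebra k k⟦X⟧) [IsIntegralClosure k⟦X⟧ R k⸨X⸩] :
    ∀ f ∈ R, constantCoeff f ≠ 0 → f⁻¹ ∈ R := by
  intro f hf h
  have : Algebra.IsIntegral R k⟦X⟧ := IsIntegralClosure.isIntegral_algebra R k⸨X⸩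
  have hu : IsUnit (⟨f, hf⟩ : R) := by
    have hl : IsLocalHom (algebraMap R k⟦X⟧) :=
      RingHom.IsIntegral.isLocalHom (algebraMap_isIntegral_iff.2 this) Subtype.val_injective
    refine hl.map_nonunit _ ?_
    exact PowerSeries.isUnit_iff_constantCoeff.2 (isUnit_iff_ne_zero.2 h)
  obtain ⟨g, hg⟩ := hu.exists_right_inv
  have hg' : f * (g : k⟦X⟧) = 1 := congrArg Subtype.val hg
  have : f⁻¹ = g := by
    rw [← mul_one f⁻¹, ← hg', ← mul_assoc, PowerSeries.inv_mul_cancel _ h, one_mul]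
  exact this ▸ g.2

theorem X_pow_mul_dvd_of_mem_pow {A : Subalgebra k k⟦X⟧} {I : Ideal A} {e : ℕ}
    (hI : ∀ f ∈ I, (X : k⟦X⟧) ^ e ∣ f) (j : ℕ) {f : A} (hf : f ∈ I ^ j) :
    (X : k⟦X⟧) ^ (e * j) ∣ f := by
  have h1 : I.map A.val ≤ Ideal.span {(X : k⟦X⟧) ^ e} :=
    Ideal.map_le_iff_le_comap.2 fun f hf => Ideal.mem_span_singleton.2 (hI f hf)
  have h2 := Ideal.pow_right_mono h1 j (Ideal.map_pow A.val I j ▸ Ideal.mem_map_of_mem A.val hf)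
  rwa [Ideal.span_singleton_pow, Ideal.mem_span_singleton, ← pow_mul] at h2

/-- The first member of the Herzog--Kunz sequence is the least value of the maximal ideal. -/
theorem X_pow_dvd_of_mem_maximalIdeal {A : Subalgebra k k⟦X⟧} [IsLocalRing A]
    (hA : ∀ f ∈ A, constantCoeff f ≠ 0 → f⁻¹ ∈ A) {n : ℕ} (hn : 0 < n) {a : Fin n → ℕ}
    (ha : IsHKSequence A a) : ∀ f ∈ IsLocalRing.maximalIdeal A, (X : k⟦X⟧) ^ a ⟨0, hn⟩ ∣ f := by
  classical
  have ha0 : a ⟨0, hn⟩ ∈ valueSet (IsLocalRing.maximalIdeal A) :=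
    (ha.2 ▸ Set.mem_range_self (f := a) ⟨0, hn⟩ :).1
  have hex : ∃ w, w ∈ valueSet (IsLocalRing.maximalIdeal A) := ⟨_, ha0⟩
  have hμ : ∀ f ∈ IsLocalRing.maximalIdeal A, (X : k⟦X⟧) ^ Nat.find hex ∣ f := by
    intro f hf
    by_cases h0 : (f : k⟦X⟧) = 0
    · simp [h0]
    obtain ⟨w, hw⟩ := exists_order_eq h0
    exact (pow_dvd_pow _ (Nat.find_min' hex ⟨f, hf, hw⟩)).trans (X_pow_dvd_of_order hw)
  have hpos : 0 < Nat.find hex := by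
    obtain ⟨f, hf, hw⟩ := Nat.find_spec hex
    rw [Nat.pos_iff_ne_zero]
    intro h0
    rw [h0] at hw
    exact coeff_ne_zero_of_order hw (by simpa using (mem_maximalIdeal_iff hA f).1 hf)
  -- With μ the least value of the maximal ideal, its square has values ≥ 2μ > μ, so μ belongs to
  -- the sequence.
  have h2 : Nat.find hex ∈ Set.range a := by
    rw [ha.2]
    refine ⟨Nat.find_spec hex, fun ⟨f, hf, hw⟩ => ?_⟩
    have := le_order_iff_X_pow_dvd.2 (X_pow_mul_dvd_of_mem_pow hμ 2 hf)
    rw [hw, Nat.cast_le] at this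
    omega
  obtain ⟨i, hi⟩ := h2
  have : a ⟨0, hn⟩ ≤ Nat.find hex := hi ▸ ha.1.monotone (Fin.mk_le_of_le_val (Nat.zero_le _))
  exact fun f hf => (pow_dvd_pow _ this).trans (hμ f hf)

/-- In a complete subalgebra, power series in a nonunit converge. -/
theorem exists_sum_of_isAdicComplete (R : Subalgebra k k⟦X⟧) {I : Ideal R} [IsAdicComplete I R]
    (hI : ∀ f ∈ I, (X : k⟦X⟧) ∣ f) {y : R} (hy : y ∈ I) (γ : ℕ → k) :
    ∃ L : R, ∀ Q, (X : k⟦X⟧) ^ Q ∣ L - ∑ q ∈ range Q, γ q • (y : k⟦X⟧) ^ q := by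
  obtain ⟨L, hL⟩ := IsPrecomplete.prec (I := I) (M := R) inferInstance
    (f := fun Q => ∑ q ∈ range Q, γ q • y ^ q) (by
      intro m n hmn
      rw [SModEq.comm, SModEq.sub_mem, ← sum_Ico_eq_sub _ hmn, smul_eq_mul, Ideal.mul_top]
      refine sum_mem fun q hq => ?_
      exact Submodule.smul_of_tower_mem _ _
        (Ideal.pow_le_pow_right (mem_Ico.1 hq).1 (Ideal.pow_mem_pow hy q)))
  refine ⟨L, fun Q => ?_⟩
  have h1 := hL Q
  rw [SModEq.comm, SModEq.sub_mem, smul_eq_mul, Ideal.mul_top] at h1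
  have h2 := X_pow_mul_dvd_of_mem_pow (e := 1) (by simpa using hI) Q h1
  simpa using h2

/-! ### The conductor -/

/-- By completeness, series in y converge in R, and k⟦t⟧ is generated over them by 1, t, …, t^(e-1).
A common denominator of these finitely many powers is a nonzero element of the conductor. -/
theorem exists_order_eq_of_mem_conductorIdeal (R : Subalgebra k k⟦X⟧) {I : Ideal R}
    [IsAdicComplete I R] [IsFractionRing R k⸨X⸩] (hI : ∀ f ∈ I, (X : k⟦X⟧) ∣ f)
    {y : R} (hy : y ∈ I) {e : ℕ} (hye : (y : k⟦X⟧).order = e) :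
    ∃ q ∈ conductorIdeal R, (q : k⟦X⟧) ≠ 0 := by
  classical
  have he : 0 < e := by
    rw [Nat.pos_iff_ne_zero]
    rintro rfl
    refine coeff_ne_zero_of_order hye ?_
    simpa using X_dvd_iff.1 (hI y hy)
  obtain ⟨q, hq⟩ := IsLocalization.exist_integer_multiples_of_finset (nonZeroDivisors R)
    ((range e).image fun r => algebraMap k⟦X⟧ k⸨X⸩ (X ^ r))
  have hq' : ∀ r < e, ((q : R) : k⟦X⟧) * X ^ r ∈ R := by
    intro r hr
    obtain ⟨z, hz⟩ := hq _ (mem_image_of_mem _ (mem_range.2 hr))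
    have : (z : k⟦X⟧) = ((q : R) : k⟦X⟧) * X ^ r := by
      apply IsFractionRing.injective k⟦X⟧ k⸨X⸩
      rw [map_mul]
      rw [Algebra.smul_def] at hz
      exact hz
    exact this ▸ z.2
  refine ⟨q, fun f => ?_, ?_⟩
  · obtain ⟨γ, hγ⟩ := exists_expansion (N := 0) he hye (fun r => X ^ r)
      (fun r _ => by simp) (f := f) (by simp)
    choose L hL using fun r => exists_sum_of_isAdicComplete R hI hy (γ r)
    rw [hγ (fun r => L r) hL, mul_sum]
    refine R.sum_mem fun r hr => ?_
    rw [mul_left_comm]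
    exact R.mul_mem (L r).2 (hq' r (mem_range.1 hr))
  · exact fun h => nonZeroDivisors.coe_ne_zero q (Subtype.ext h)

/-- An element of least value in the conductor divides, in k⟦t⟧, everything of at least that value.
The nonzero element is needed: otherwise `conductorDegree` is the infimum of the empty set, which is
0. -/
theorem mem_conductorIdeal_iff {R : Subalgebra k k⟦X⟧}
    (hR : ∃ q ∈ conductorIdeal R, (q : k⟦X⟧) ≠ 0) (f : R) :
    f ∈ conductorIdeal R ↔ (X : k⟦X⟧) ^ conductorDegree R ∣ f := by
  obtain ⟨q, hq, hq0⟩ := hR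
  obtain ⟨m, hm⟩ := exists_order_eq hq0
  obtain ⟨p, hp, hpc⟩ : conductorDegree R ∈ valueSet (conductorIdeal R) :=
    Nat.sInf_mem ⟨m, q, hq, hm⟩
  refine ⟨fun hf => ?_, fun hf g => ?_⟩
  · by_cases h0 : (f : k⟦X⟧) = 0
    · simp [h0]
    obtain ⟨w, hw⟩ := exists_order_eq h0
    have hcw : conductorDegree R ≤ w := Nat.sInf_le ⟨f, hf, hw⟩
    exact (pow_dvd_pow _ hcw).trans (X_pow_dvd_of_order hw)
  · obtain ⟨z, hz⟩ := exists_mul_eq_of_X_pow_dvd hpc hf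
    rw [← hz, mul_assoc]
    exact hp _

theorem mem_of_X_pow_conductorDegree_dvd {R : Subalgebra k k⟦X⟧}
    (hR : ∃ q ∈ conductorIdeal R, (q : k⟦X⟧) ≠ 0) {f : k⟦X⟧}
    (hf : (X : k⟦X⟧) ^ conductorDegree R ∣ f) : f ∈ R := by
  obtain ⟨q, hq, hq0⟩ := hR
  obtain ⟨m, hm⟩ := exists_order_eq hq0
  obtain ⟨p, hp, hpc⟩ : conductorDegree R ∈ valueSet (conductorIdeal R) :=
    Nat.sInf_mem ⟨m, q, hq, hm⟩
  obtain ⟨z, hz⟩ := exists_mul_eq_of_X_pow_dvd hpc hf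
  exact hz ▸ hp z

/-! ### The ring R + t^d k⟦t⟧ and its maximal ideal -/

/-- An ideal of a subalgebra of `k⟦t⟧` as a `k`-subspace of `k⟦t⟧`. -/
def idealSubspace {A : Subalgebra k k⟦X⟧} (I : Ideal A) : Submodule k k⟦X⟧ :=
  (I.restrictScalars k).map A.val.toLinearMap

theorem mem_idealSubspace {A : Subalgebra k k⟦X⟧} {I : Ideal A} {f : k⟦X⟧} :
    f ∈ idealSubspace I ↔ ∃ g ∈ I, (g : k⟦X⟧) = f :=
  Iff.rfl

theorem coe_mem_idealSubspace {A : Subalgebra k k⟦X⟧} {I : Ideal A} {f : A} :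
    (f : k⟦X⟧) ∈ idealSubspace I ↔ f ∈ I :=
  ⟨fun ⟨_, hg, h⟩ => Subtype.ext h ▸ hg, fun h => ⟨f, h, rfl⟩⟩

theorem mem_valueSet_iff {A : Subalgebra k k⟦X⟧} {I : Ideal A} {w : ℕ} :
    w ∈ valueSet I ↔ ∃ f ∈ idealSubspace I, f.order = w :=
  ⟨fun ⟨f, hf, h⟩ => ⟨f, ⟨f, hf, rfl⟩, h⟩, fun ⟨_, ⟨f, hf, rfl⟩, h⟩ => ⟨f, hf, h⟩⟩

/-- The adjoined quotients form the ideal t^d k⟦t⟧ of k⟦t⟧, so adding it to R already gives a ring.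
-/
theorem mem_conductorExtension_iff {R : Subalgebra k k⟦X⟧}
    (hR : ∃ q ∈ conductorIdeal R, (q : k⟦X⟧) ≠ 0) {y : R} {e d : ℕ} (hy : (y : k⟦X⟧).order = e)
    (hc : conductorDegree R = e + d) (f : k⟦X⟧) :
    f ∈ conductorExtension R y ↔ ∃ r ∈ R, (X : k⟦X⟧) ^ d ∣ f - r := by
  have hset : {g : k⟦X⟧ | ∃ h ∈ conductorIdeal R, (y : k⟦X⟧) * g = h} =
      {g | (X : k⟦X⟧) ^ d ∣ g} := by
    ext g
    rw [Set.mem_ofPred_eq, Set.mem_ofPred_eq, ← X_pow_dvd_mul_iff hy, ← hc]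
    refine ⟨fun ⟨h, hh, hg⟩ => hg ▸ (mem_conductorIdeal_iff hR h).1 hh, fun hg => ?_⟩
    exact ⟨⟨_, mem_of_X_pow_conductorDegree_dvd hR hg⟩,
      (mem_conductorIdeal_iff hR _).2 hg, rfl⟩
  let B : Subalgebra R k⟦X⟧ :=
    { carrier := {f | ∃ r ∈ R, (X : k⟦X⟧) ^ d ∣ f - r}
      mul_mem' := by
        rintro f g ⟨r, hr, hf⟩ ⟨r', hr', hg⟩
        refine ⟨r * r', R.mul_mem hr hr', ?_⟩
        have : f * g - r * r' = (f - r) * g + r * (g - r') := by ring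
        exact this ▸ dvd_add (hf.mul_right _) (hg.mul_left _)
      add_mem' := by
        rintro f g ⟨r, hr, hf⟩ ⟨r', hr', hg⟩
        refine ⟨r + r', R.add_mem hr hr', ?_⟩
        have : f + g - (r + r') = (f - r) + (g - r') := by ring
        exact this ▸ dvd_add hf hg
      algebraMap_mem' := fun r => ⟨r, r.2, by
        simp [Algebra.algebraMap_eq_smul_one, Subalgebra.smul_def]⟩ }
  rw [conductorExtension, hset, Subalgebra.mem_restrictScalars]
  refine ⟨fun hf => ?_, fun ⟨r, hr, hf⟩ => ?_⟩
  · have : Algebra.adjoin R {g : k⟦X⟧ | (X : k⟦X⟧) ^ d ∣ g} ≤ B :=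
      Algebra.adjoin_le fun g hg => ⟨0, R.zero_mem, by simpa using hg⟩
    exact this hf
  · have h1 : f - r ∈ Algebra.adjoin R {g : k⟦X⟧ | (X : k⟦X⟧) ^ d ∣ g} :=
      Algebra.subset_adjoin hf
    have h2 : r ∈ Algebra.adjoin R {g : k⟦X⟧ | (X : k⟦X⟧) ^ d ∣ g} :=
      Subalgebra.algebraMap_mem _ (⟨r, hr⟩ : R)
    simpa using add_mem h1 h2

theorem inv_mem_of_mem_iff {R S : Subalgebra k k⟦X⟧} {d : ℕ} (hd : 0 < d)
    (hS : ∀ f, f ∈ S ↔ ∃ r ∈ R, (X : k⟦X⟧) ^ d ∣ f - r)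
    (hR : ∀ f ∈ R, constantCoeff f ≠ 0 → f⁻¹ ∈ R) :
    ∀ f ∈ S, constantCoeff f ≠ 0 → f⁻¹ ∈ S := by
  intro f hf h
  obtain ⟨r, hr, hfr⟩ := (hS f).1 hf
  have hr0 : constantCoeff r ≠ 0 := by
    have := X_dvd_iff.1 ((dvd_pow_self X hd.ne').trans hfr)
    rw [map_sub, sub_eq_zero] at this
    exact this ▸ h
  refine (hS _).2 ⟨r⁻¹, hR r hr hr0, ?_⟩
  have : f⁻¹ - r⁻¹ = -(f⁻¹ * r⁻¹) * (f - r) := by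
    have h1 := PowerSeries.inv_mul_cancel f h
    have h2 := PowerSeries.inv_mul_cancel r hr0
    linear_combination r⁻¹ * h1 - f⁻¹ * h2
  exact this ▸ hfr.mul_left _

section Extension

variable {R S : Subalgebra k k⟦X⟧} [IsLocalRing R] [IsLocalRing S] {c d e : ℕ}

theorem exists_mem_maximalIdeal_of_mem (hd : 0 < d)
    (hS : ∀ f, f ∈ S ↔ ∃ r ∈ R, (X : k⟦X⟧) ^ d ∣ f - r)
    (hR : ∀ f ∈ R, constantCoeff f ≠ 0 → f⁻¹ ∈ R) {f : S}
    (hf : f ∈ IsLocalRing.maximalIdeal S) :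
    ∃ r ∈ IsLocalRing.maximalIdeal R, (X : k⟦X⟧) ^ d ∣ f - r := by
  obtain ⟨r, hr, hfr⟩ := (hS f).1 f.2
  refine ⟨⟨r, hr⟩, (mem_maximalIdeal_iff hR _).2 ?_, hfr⟩
  have := X_dvd_iff.1 ((dvd_pow_self X hd.ne').trans hfr)
  rw [map_sub, sub_eq_zero] at this
  rw [← this]
  exact (mem_maximalIdeal_iff (inv_mem_of_mem_iff hd hS hR) f).1 hf

theorem idealSubspace_maximalIdeal_sq_eq (hd : 0 < d)
    (hS : ∀ f, f ∈ S ↔ ∃ r ∈ R, (X : k⟦X⟧) ^ d ∣ f - r)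
    (hR : ∀ f ∈ R, constantCoeff f ≠ 0 → f⁻¹ ∈ R)
    (he : ∀ f ∈ IsLocalRing.maximalIdeal R, (X : k⟦X⟧) ^ e ∣ f) (hed : e ≤ d)
    (hc : ∀ f, (X : k⟦X⟧) ^ (e + d) ∣ f → f ∈ idealSubspace (IsLocalRing.maximalIdeal R ^ 2)) :
    idealSubspace (IsLocalRing.maximalIdeal S ^ 2) =
      idealSubspace (IsLocalRing.maximalIdeal R ^ 2) := by
  have hRS : R ≤ S := fun f hf => (hS f).2 ⟨f, hf, by simp⟩
  apply le_antisymm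
  · rintro _ ⟨f, hf, rfl⟩
    have hf' : f ∈ IsLocalRing.maximalIdeal S ^ 2 := hf
    rw [pow_two] at hf'
    change (f : k⟦X⟧) ∈ _
    refine Submodule.mul_induction_on hf' (fun p hp q hq => ?_) fun p q hp hq => ?_
    · obtain ⟨r, hr, hpr⟩ := exists_mem_maximalIdeal_of_mem hd hS hR hp
      obtain ⟨r', hr', hqr⟩ := exists_mem_maximalIdeal_of_mem hd hS hR hq
      have h1 : ((r * r' : R) : k⟦X⟧) ∈ idealSubspace (IsLocalRing.maximalIdeal R ^ 2) :=
        coe_mem_idealSubspace.2 (pow_two (IsLocalRing.maximalIdeal R) ▸ Ideal.mul_mem_mul hr hr')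
      have h2 : (X : k⟦X⟧) ^ (e + d) ∣ (p * q : S) - (r * r' : R) := by
        have : ((p * q : S) : k⟦X⟧) - (r * r' : R) =
            r * (q - r') + r' * (p - r) + (p - r) * (q - r') := by
          push_cast
          ring
        rw [this, pow_add]
        -- The mixed terms have value ≥ e + d; the last has value ≥ 2d ≥ e + d.
        exact dvd_add (dvd_add (mul_dvd_mul (he r hr) hqr) (mul_dvd_mul (he r' hr') hpr))
          (mul_dvd_mul ((pow_dvd_pow _ hed).trans hpr) hqr)
      simpa using Submodule.add_mem _ (hc _ h2) h1
    · exact Submodule.add_mem _ hp hq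
  · rintro _ ⟨f, hf, rfl⟩
    have hm : (IsLocalRing.maximalIdeal R).map (Subalgebra.inclusion hRS) ≤
        IsLocalRing.maximalIdeal S := by
      refine Ideal.map_le_iff_le_comap.2 fun f hf => ?_
      exact (mem_maximalIdeal_iff (inv_mem_of_mem_iff hd hS hR) _).2
        ((mem_maximalIdeal_iff hR f).1 hf)
    refine ⟨Subalgebra.inclusion hRS f, Ideal.pow_right_mono hm 2 ?_, rfl⟩
    exact Ideal.map_pow (Subalgebra.inclusion hRS) _ 2 ▸ Ideal.mem_map_of_mem _ hf

/-- As the squares agree, only new values of 𝔪_S matter. Below d, elements of S have the values of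
their approximations in R; from e + d on, every value is attained in the square; in between, t^w
itself lies in S. -/
theorem valueSet_maximalIdeal_sdiff_eq (hd : 0 < d)
    (hS : ∀ f, f ∈ S ↔ ∃ r ∈ R, (X : k⟦X⟧) ^ d ∣ f - r)
    (hR : ∀ f ∈ R, constantCoeff f ≠ 0 → f⁻¹ ∈ R)
    (he : ∀ f ∈ IsLocalRing.maximalIdeal R, (X : k⟦X⟧) ^ e ∣ f) (hed : e ≤ d)
    (hc : ∀ f, (X : k⟦X⟧) ^ (e + d) ∣ f → f ∈ idealSubspace (IsLocalRing.maximalIdeal R ^ 2)) :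
    valueSet (IsLocalRing.maximalIdeal S) \ valueSet (IsLocalRing.maximalIdeal S ^ 2) =
      valueSet (IsLocalRing.maximalIdeal R) \ valueSet (IsLocalRing.maximalIdeal R ^ 2) ∪
        {w | d ≤ w ∧ w < e + d ∧ w ∉ valueSemigroup R} := by
  have hRS : R ≤ S := fun f hf => (hS f).2 ⟨f, hf, by simp⟩
  have hsq : valueSet (IsLocalRing.maximalIdeal S ^ 2) =
      valueSet (IsLocalRing.maximalIdeal R ^ 2) := by
    ext w
    rw [mem_valueSet_iff, mem_valueSet_iff, idealSubspace_maximalIdeal_sq_eq hd hS hR he hed hc]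
  have hRSm : valueSet (IsLocalRing.maximalIdeal R) ⊆ valueSet (IsLocalRing.maximalIdeal S) := by
    rintro w ⟨f, hf, hw⟩
    exact ⟨Subalgebra.inclusion hRS f, (mem_maximalIdeal_iff (inv_mem_of_mem_iff hd hS hR) _).2
      ((mem_maximalIdeal_iff hR f).1 hf), hw⟩
  rw [hsq]
  ext w
  constructor
  · rintro ⟨⟨f, hf, hw⟩, hw2⟩
    by_cases hwR : w ∈ valueSet (IsLocalRing.maximalIdeal R)
    · exact Or.inl ⟨hwR, hw2⟩
    refine Or.inr ⟨?_, ?_, ?_⟩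
    · by_contra! hwd
      refine hwR ?_
      obtain ⟨r, hr, hfr⟩ := exists_mem_maximalIdeal_of_mem hd hS hR hf
      refine ⟨r, hr, ?_⟩
      have hcoe : ∀ i ≤ w, coeff i (r : k⟦X⟧) = coeff i (f : k⟦X⟧) := by
        intro i hi
        have := X_pow_dvd_iff.1 hfr i (by omega)
        rw [map_sub, sub_eq_zero] at this
        exact this.symm
      rw [order_eq_nat] at hw ⊢
      exact ⟨hcoe w le_rfl ▸ hw.1, fun i hi => hcoe i hi.le ▸ hw.2 i hi⟩
    · by_contra! hwc
      exact hw2 (mem_valueSet_iff.2 ⟨f, hc _ ((pow_dvd_pow _ hwc).trans (X_pow_dvd_of_order hw)),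
        hw⟩)
    · rintro ⟨r, -, hr⟩
      refine hwR ⟨r, (mem_maximalIdeal_iff hR r).2 ?_, hr⟩
      have h0 := (mem_maximalIdeal_iff (inv_mem_of_mem_iff hd hS hR) f).1 hf
      rw [← coeff_zero_eq_constantCoeff_apply] at h0 ⊢
      refine (order_eq_nat.1 hr).2 0 (Nat.pos_of_ne_zero ?_)
      rintro rfl
      exact coeff_ne_zero_of_order hw h0
  · rintro (hw | ⟨hdw, hwc, hw⟩)
    · exact ⟨hRSm hw.1, hw.2⟩
    · refine ⟨⟨⟨X ^ w, (hS _).2 ⟨0, R.zero_mem, by simpa using pow_dvd_pow _ hdw⟩⟩, ?_, by simp⟩,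
        fun ⟨f, _, hf⟩ => hw ⟨f, trivial, hf⟩⟩
      refine (mem_maximalIdeal_iff (inv_mem_of_mem_iff hd hS hR) _).2 ?_
      simp only [map_pow, constantCoeff_X]
      exact zero_pow (by omega)

end Extension

/-! ### The reduced type -/

/-- The exponents are distinct, so a nonzero combination has one of the b i as its value, which no
element of R has. -/
theorem sum_smul_X_pow_eq_zero {R : Subalgebra k k⟦X⟧} {s : ℕ} {b : Fin s → ℕ}
    (hb : Function.Injective b) (hbR : ∀ i, b i ∉ valueSemigroup R) {β : Fin s → k}
    (h : ∑ i, β i • (X : k⟦X⟧) ^ b i ∈ R) : β = 0 := by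
  have hcoeff : ∀ w, coeff w (∑ i, β i • (X : k⟦X⟧) ^ b i) = ∑ i, if w = b i then β i else 0 := by
    intro w
    simp [coeff_X_pow]
  by_cases h0 : ∑ i, β i • (X : k⟦X⟧) ^ b i = 0
  · funext i
    have := hcoeff (b i)
    rw [h0] at this
    simpa [hb.eq_iff] using this.symm
  · obtain ⟨w, hw⟩ := exists_order_eq h0
    obtain ⟨i, -, hi⟩ := exists_ne_zero_of_sum_ne_zero (hcoeff w ▸ coeff_ne_zero_of_order hw)
    have hwi : w = b i := by
      by_contra hne
      exact hi (if_neg hne)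
    exact absurd ⟨⟨_, h⟩, trivial, hwi ▸ hw⟩ (hbR i)

theorem reducedType_eq {R : Subalgebra k k⟦X⟧} (hR : ∃ q ∈ conductorIdeal R, (q : k⟦X⟧) ≠ 0)
    {y : R} {e d : ℕ} (hy : (y : k⟦X⟧).order = e) (hc : conductorDegree R = e + d) {s : ℕ}
    {b : Fin s → ℕ} (hb : Function.Injective b)
    (hb_range : Set.range b = {w | d ≤ w ∧ w < e + d ∧ w ∉ valueSemigroup R}) :
    reducedType R y = s := by
  have hbi : ∀ i, d ≤ b i ∧ b i < e + d ∧ b i ∉ valueSemigroup R := fun i =>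
    hb_range.subset (Set.mem_range_self i)
  let Λ : (Fin s → k) →ₗ[k] k⟦X⟧ := Fintype.linearCombination k fun i => (X : k⟦X⟧) ^ b i
  have hΛ : ∀ β, Λ β = ∑ i, β i • (X : k⟦X⟧) ^ b i := fun β => rfl
  have hdvd : ∀ β, (X : k⟦X⟧) ^ conductorDegree R ∣ (y : k⟦X⟧) * Λ β := by
    intro β
    rw [hc, X_pow_dvd_mul_iff hy, hΛ]
    exact dvd_sum fun i _ => dvd_smul_of_dvd _ (pow_dvd_pow _ (hbi i).1)
  let Φ : (Fin s → k) →ₗ[k] R := LinearMap.codRestrict (Subalgebra.toSubmodule R)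
    ((LinearMap.mulLeft k (y : k⟦X⟧)).comp Λ)
    fun β => mem_of_X_pow_conductorDegree_dvd hR (hdvd β)
  let I : Ideal (R ⧸ Ideal.span {y}) :=
    (conductorIdeal R).map (Ideal.Quotient.mk (Ideal.span {y}))
  let Ψ : (Fin s → k) →ₗ[k] I.restrictScalars k := LinearMap.codRestrict (I.restrictScalars k)
    ((Ideal.Quotient.mkₐ k (Ideal.span {y})).toLinearMap.comp Φ)
    fun β => Ideal.mem_map_of_mem _ ((mem_conductorIdeal_iff hR _).2 (hdvd β))
  have hinj : Function.Injective Ψ := by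
    rw [← LinearMap.ker_eq_bot, LinearMap.ker_eq_bot']
    intro β hβ
    have h1 : Ideal.Quotient.mk (Ideal.span {y}) (Φ β) = 0 := congrArg Subtype.val hβ
    rw [Ideal.Quotient.eq_zero_iff_mem, Ideal.mem_span_singleton] at h1
    obtain ⟨r, hr⟩ := h1
    have h2 : (y : k⟦X⟧) * Λ β = y * r := congrArg Subtype.val hr
    exact sum_smul_X_pow_eq_zero hb (fun i => (hbi i).2.2)
      (mul_left_cancel₀ (ne_zero_of_order hy) h2 ▸ r.2 : Λ β ∈ R)
  -- Each value in [d, e + d) is attained by R or by some t^{bᵢ}, and R contains everything of value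
  -- ≥ e + d.
  have hspan : (Ideal.span {(X : k⟦X⟧) ^ d}).restrictScalars k ≤
      Subalgebra.toSubmodule R ⊔ LinearMap.range Λ := by
    refine submodule_le_of_values (e + d) (fun f _ hf => Submodule.mem_sup_left ?_) ?_
    · exact mem_of_X_pow_conductorDegree_dvd hR (hc ▸ hf)
    · intro f hf w hwc hw
      have hf' : (X : k⟦X⟧) ^ d ∣ f := Ideal.mem_span_singleton.1 hf
      have hdw : d ≤ w := by
        have := le_order_iff_X_pow_dvd.2 hf'
        rwa [hw, Nat.cast_le] at this
      have hU : ∀ g : k⟦X⟧, g.order = w → g ∈ (Ideal.span {(X : k⟦X⟧) ^ d}).restrictScalars k :=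
        fun g hg => Ideal.mem_span_singleton.2
          ((pow_dvd_pow _ hdw).trans (X_pow_dvd_of_order hg))
      by_cases hwR : w ∈ valueSemigroup R
      · obtain ⟨r, -, hr⟩ := hwR
        exact ⟨r, Submodule.mem_sup_left r.2, hU _ hr, hr⟩
      · obtain ⟨i, rfl⟩ : w ∈ Set.range b := hb_range.superset ⟨hdw, hwc, hwR⟩
        refine ⟨X ^ b i, Submodule.mem_sup_right ⟨Pi.single i 1, ?_⟩, hU _ (by simp), by simp⟩
        rw [hΛ]
        simp [Pi.single_apply]
  have hsurj : Function.Surjective Ψ := by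
    rintro ⟨z, hz⟩
    obtain ⟨f, hf, rfl⟩ := (Ideal.mem_map_iff_of_surjective _ Ideal.Quotient.mk_surjective).1 hz
    have hf' := hc ▸ (mem_conductorIdeal_iff hR f).1 hf
    obtain ⟨g, hg⟩ := exists_mul_eq_of_X_pow_dvd hy
      ((pow_dvd_pow X (Nat.le_add_right e d)).trans hf')
    rw [← hg, X_pow_dvd_mul_iff hy] at hf'
    obtain ⟨r, hr, _, ⟨β, rfl⟩, hgr⟩ := Submodule.mem_sup.1
      (hspan (show g ∈ (Ideal.span {(X : k⟦X⟧) ^ d}).restrictScalars k from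
        Ideal.mem_span_singleton.2 hf'))
    refine ⟨β, Subtype.ext ?_⟩
    change Ideal.Quotient.mk (Ideal.span {y}) (Φ β) = _
    rw [Ideal.Quotient.eq, Ideal.mem_span_singleton]
    refine ⟨⟨-r, R.neg_mem hr⟩, Subtype.ext ?_⟩
    change (y : k⟦X⟧) * Λ β - f = y * (-r)
    rw [← hg, ← hgr]
    ring
  have := (LinearEquiv.ofBijective Ψ ⟨hinj, hsurj⟩).finrank_eq
  rw [Module.finrank_fin_fun] at this
  exact this.symm

/-! ### Merging the gaps into the sequence -/

/-- Inserting numbers `b i ≥ d` into a strictly increasing sequence of which exactly the first `i₀`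
members are less than `d`. -/
theorem exists_strictMono_insert {n s : ℕ} {a : Fin n → ℕ} (ha : StrictMono a) {b : Fin s → ℕ}
    (hb : Function.Injective b) (hab : Disjoint (Set.range a) (Set.range b)) {d i₀ : ℕ}
    (hbd : ∀ i, d ≤ b i) (hi₀n : i₀ ≤ n) (hi₀ : ∀ i : Fin n, (i : ℕ) < i₀ ↔ a i < d) :
    ∃ a' : Fin (n + s) → ℕ, StrictMono a' ∧ Set.range a' = Set.range a ∪ Set.range b ∧
      a' '' {j | i₀ ≤ (j : ℕ)} = a '' {j | i₀ ≤ (j : ℕ)} ∪ Set.range b ∧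
      ∀ j : Fin n, (j : ℕ) < i₀ → a' (Fin.castAdd s j) = a j := by
  classical
  let T : Finset ℕ := (univ.filter fun j : Fin n => i₀ ≤ (j : ℕ)).image a ∪ univ.image b
  have hT : (T : Set ℕ) = a '' {j | i₀ ≤ (j : ℕ)} ∪ Set.range b := by
    simp [T]
  have hTd : ∀ w ∈ T, d ≤ w := by
    intro w hw
    rw [← Finset.mem_coe, hT] at hw
    rcases hw with ⟨j, hj, rfl⟩ | ⟨i, rfl⟩
    · exact not_lt.1 fun h => not_lt.2 hj ((hi₀ j).2 h)
    · exact hbd i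
  have hcard : T.card = n + s - i₀ := by
    have h1 : (univ.filter fun j : Fin n => (j : ℕ) < i₀).card = i₀ := by
      rw [Fin.card_filter_val_lt, min_eq_right hi₀n]
    have h2 := card_filter_add_card_filter_not (s := (univ : Finset (Fin n)))
      (fun j => (j : ℕ) < i₀)
    simp only [not_lt, card_univ, Fintype.card_fin, h1] at h2
    rw [card_union_of_disjoint, card_image_of_injective _ ha.injective,
      card_image_of_injective _ hb, card_univ, Fintype.card_fin]
    · omega
    · rw [Finset.disjoint_left]
      intro w hw hw'
      obtain ⟨j, -, rfl⟩ := mem_image.1 hw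
      obtain ⟨i, -, hi⟩ := mem_image.1 hw'
      exact Set.disjoint_left.1 hab ⟨j, rfl⟩ ⟨i, hi⟩
  let t := T.orderEmbOfFin hcard
  have ht : Set.range t = T := T.range_orderEmbOfFin hcard
  -- The members below d keep their places; the sorted set `T`, all of it ≥ d, follows them.
  let a' : Fin (n + s) → ℕ := fun j =>
    if h : (j : ℕ) < i₀ then a ⟨j, by omega⟩ else t ⟨j - i₀, by omega⟩
  have hlow : ∀ j : Fin (n + s), ∀ h : (j : ℕ) < i₀, a' j = a ⟨j, by omega⟩ := fun j h => dif_pos h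
  have hhigh : ∀ j : Fin (n + s), ∀ h : ¬ (j : ℕ) < i₀, a' j = t ⟨j - i₀, by omega⟩ :=
    fun j h => dif_neg h
  have himage : a' '' {j | i₀ ≤ (j : ℕ)} = a '' {j | i₀ ≤ (j : ℕ)} ∪ Set.range b := by
    rw [← hT, ← ht]
    ext w
    constructor
    · rintro ⟨j, hj, rfl⟩
      exact ⟨_, (hhigh j (not_lt.2 hj)).symm⟩
    · rintro ⟨i, rfl⟩
      have hi := i.2
      refine ⟨⟨i + i₀, by omega⟩, Nat.le_add_left _ _, ?_⟩
      rw [hhigh _ (by simp)]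
      congr 1
      ext
      simp
  refine ⟨a', ?_, ?_, himage, fun j hj => hlow _ hj⟩
  · intro i j hij
    have hij' : (i : ℕ) < j := hij
    by_cases hj : (j : ℕ) < i₀
    · rw [hlow i (hij'.trans hj), hlow j hj]
      exact ha hij'
    · rw [hhigh j hj]
      by_cases hi : (i : ℕ) < i₀
      · rw [hlow i hi]
        exact ((hi₀ ⟨i, by omega⟩).1 hi).trans_le (hTd _ (T.orderEmbOfFin_mem hcard _))
      · rw [hhigh i hi]
        refine t.strictMono ?_
        change (i : ℕ) - i₀ < j - i₀
        omega
  · apply Set.eq_of_subset_of_subset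
    · rintro _ ⟨j, rfl⟩
      by_cases hj : (j : ℕ) < i₀
      · exact Or.inl ⟨_, (hlow j hj).symm⟩
      · rcases himage.subset ⟨j, not_lt.1 hj, rfl⟩ with ⟨i, -, hi⟩ | h
        · exact Or.inl ⟨i, hi⟩
        · exact Or.inr h
    · rintro _ (⟨j, rfl⟩ | h)
      · by_cases hj : (j : ℕ) < i₀
        · exact ⟨Fin.castAdd s j, hlow _ hj⟩
        · obtain ⟨i, -, hi⟩ := himage.superset (Or.inl ⟨j, not_lt.1 hj, rfl⟩)
          exact ⟨i, hi⟩
      · obtain ⟨i, -, hi⟩ := himage.superset (Or.inr h)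
        exact ⟨i, hi⟩

/-! ### Evaluation of power series and parametrization -/

/-- Evaluation of power series in `n` variables at elements of `k⟦t⟧`. -/
def evalHom {n : ℕ} {x : Fin n → k⟦X⟧}
    (hx : MvPowerSeries.HasSubst (fun i => (x i : MvPowerSeries Unit k))) :
    MvPowerSeries (Fin n) k →ₐ[k] k⟦X⟧ :=
  MvPowerSeries.substAlgHom hx

theorem evalHom_apply {n : ℕ} {x : Fin n → k⟦X⟧}
    (hx : MvPowerSeries.HasSubst (fun i => (x i : MvPowerSeries Unit k)))
    (F : MvPowerSeries (Fin n) k) :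
    evalHom hx F = MvPowerSeries.subst (fun i => (x i : MvPowerSeries Unit k)) F :=
  MvPowerSeries.substAlgHom_apply hx F

theorem evalHom_X {n : ℕ} {x : Fin n → k⟦X⟧}
    (hx : MvPowerSeries.HasSubst (fun i => (x i : MvPowerSeries Unit k))) (i : Fin n) :
    evalHom hx (MvPowerSeries.X i) = x i :=
  MvPowerSeries.substAlgHom_X hx i

/-- A one-variable series is substituted into the i-th variable. Divisibility of remainders is
preserved by any algebra homomorphism, so continuity is not needed. -/
theorem exists_mem_range_evalHom {n : ℕ} {x : Fin n → k⟦X⟧}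
    (hx : MvPowerSeries.HasSubst (fun i => (x i : MvPowerSeries Unit k))) (i : Fin n)
    (γ : ℕ → k) :
    ∃ L ∈ (evalHom hx).range, ∀ Q, x i ^ Q ∣ L - ∑ q ∈ range Q, γ q • x i ^ q := by
  let θ : k⟦X⟧ →ₐ[k] k⟦X⟧ := (evalHom hx).comp (substAlgHom (HasSubst.X i))
  have hθ : θ X = x i := by
    change evalHom hx (substAlgHom (HasSubst.X i) X) = x i
    rw [substAlgHom_X, evalHom_X]
  refine ⟨θ (mk γ), ⟨_, rfl⟩, fun Q => ?_⟩
  have h1 : (X : k⟦X⟧) ^ Q ∣ mk γ - ∑ q ∈ range Q, γ q • X ^ q := by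
    rw [X_pow_dvd_iff]
    intro m hm
    simp [coeff_X_pow, hm]
  have h2 := map_dvd θ h1
  simpa [map_sub, map_sum, map_smul, map_pow, hθ] using h2

/-- Monomials of degree greater than c evaluate into t^c k⟦t⟧, so the value is a polynomial in the x
i plus an element of t^c k⟦t⟧. -/
theorem evalHom_mem {n : ℕ} {x : Fin n → k⟦X⟧}
    (hx : MvPowerSeries.HasSubst (fun i => (x i : MvPowerSeries Unit k)))
    (hX : ∀ i, (X : k⟦X⟧) ∣ x i) {A : Subalgebra k k⟦X⟧} (hxA : ∀ i, x i ∈ A) {c : ℕ}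
    (hc : ∀ f, (X : k⟦X⟧) ^ c ∣ f → f ∈ A) (F : MvPowerSeries (Fin n) k) : evalHom hx F ∈ A := by
  classical
  have hfin : {d : Fin n →₀ ℕ | d.degree ≤ c}.Finite := Finsupp.finite_of_degree_le c
  let P : k⟦X⟧ := ∑ d ∈ hfin.toFinset, MvPowerSeries.coeff d F • d.prod fun i e => x i ^ e
  have hP : P ∈ A := A.sum_mem fun d _ => A.smul_mem
    (A.prod_mem fun i _ => A.pow_mem (hxA i) _) _
  have hmon : ∀ d : Fin n →₀ ℕ, (X : k⟦X⟧) ^ d.degree ∣ d.prod fun i e => x i ^ e := by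
    intro d
    rw [Finsupp.degree_apply, ← prod_pow_eq_pow_sum]
    exact prod_dvd_prod_of_dvd _ _ fun i _ => pow_dvd_pow_of_dvd (hX i) _
  have hdvd : (X : k⟦X⟧) ^ c ∣ evalHom hx F - P := by
    rw [X_pow_dvd_iff]
    intro j hj
    have h1 : coeff j (evalHom hx F) = ∑ᶠ d : Fin n →₀ ℕ,
        MvPowerSeries.coeff d F • coeff j (d.prod fun i e => x i ^ e) := by
      rw [evalHom_apply]
      exact MvPowerSeries.coeff_subst hx F _
    rw [map_sub, h1, finsum_eq_sum_of_support_subset (s := hfin.toFinset), sub_eq_zero]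
    · simp [P]
    · intro d hd
      by_contra hdc
      simp only [Set.Finite.coe_toFinset, Set.mem_ofPred_eq, not_le] at hdc
      refine hd ?_
      simp only [X_pow_dvd_iff.1 (hmon d) j (hj.trans hdc), smul_zero]
  have := A.add_mem (hc _ hdvd) hP
  rwa [sub_add_cancel] at this

theorem idealSubspace_sq_le {A : Subalgebra k k⟦X⟧} (I : Ideal A) :
    idealSubspace (I ^ 2) ≤ idealSubspace I * idealSubspace I := by
  rintro _ ⟨f, hf, rfl⟩
  have hf' : f ∈ I ^ 2 := hf
  rw [pow_two] at hf'
  change (f : k⟦X⟧) ∈ _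
  refine Submodule.mul_induction_on hf' (fun p hp q hq => ?_) fun p q hp hq => ?_
  · exact Submodule.mul_mem_mul (coe_mem_idealSubspace.2 hp) (coe_mem_idealSubspace.2 hq)
  · exact Submodule.add_mem _ hp hq

/-- Generation modulo the square propagates to every power, as in Nakayama's lemma; this drives the
successive approximation by polynomials in the generators. -/
theorem pow_le_pow_sup_pow {M P : Submodule k k⟦X⟧} (hPM : P ≤ M) (hM : M ≤ P ⊔ M * M) (j : ℕ) :
    M ^ (j + 1) ≤ P ^ (j + 1) ⊔ M ^ (j + 2) := by
  induction j with
  | zero => simpa [pow_two] using hM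
  | succ j ih =>
    have hP : P ^ (j + 1) ≤ M ^ (j + 1) := pow_le_pow_left' hPM _
    calc M ^ (j + 1 + 1) = M ^ (j + 1) * M := pow_succ _ _
      _ ≤ (P ^ (j + 1) ⊔ M ^ (j + 2)) * M := mul_le_mul' ih le_rfl
      _ = P ^ (j + 1) * M ⊔ M ^ (j + 2) * M := Submodule.sup_mul _ _ _
      _ ≤ (P ^ (j + 1) * (P ⊔ M * M)) ⊔ M ^ (j + 1 + 2) :=
        sup_le_sup (mul_le_mul' le_rfl hM) (pow_succ M (j + 2)).ge
      _ ≤ P ^ (j + 1 + 1) ⊔ M ^ (j + 1 + 2) := by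
        rw [Submodule.mul_sup, ← pow_succ]
        refine sup_le (sup_le le_sup_left (le_sup_of_le_right ?_)) le_sup_right
        rw [pow_add M (j + 1) 2, pow_two]
        exact mul_le_mul' hP le_rfl

theorem X_pow_dvd_of_mem_pow {M : Submodule k k⟦X⟧} (hM : ∀ f ∈ M, (X : k⟦X⟧) ∣ f) (j : ℕ) :
    ∀ f ∈ M ^ j, (X : k⟦X⟧) ^ j ∣ f := by
  induction j with
  | zero => simp
  | succ j ih =>
    intro f hf
    rw [pow_succ] at hf
    refine Submodule.mul_induction_on hf (fun p hp q hq => ?_) fun p q hp hq => dvd_add hp hq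
    exact pow_succ (X : k⟦X⟧) j ▸ mul_dvd_mul (ih p hp) (hM q hq)

/-- If the square of the maximal ideal contains `t ^ c k⟦t⟧`, then the algebra is parametrized by
any Herzog--Kunz generators. -/
theorem isParametrization_of_isHKGenerators {A : Subalgebra k k⟦X⟧} [IsLocalRing A]
    (hA : ∀ f ∈ A, constantCoeff f ≠ 0 → f⁻¹ ∈ A) {c : ℕ}
    (hc : ∀ f, (X : k⟦X⟧) ^ c ∣ f → f ∈ idealSubspace (IsLocalRing.maximalIdeal A ^ 2))
    {n : ℕ} (hn : 0 < n) {a : Fin n → ℕ} (ha : IsHKSequence A a) {x : Fin n → A}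
    (hx : IsHKGenerators a x) : IsParametrization A x := by
  have hcA : ∀ f, (X : k⟦X⟧) ^ c ∣ f → f ∈ A := by
    intro f hf
    obtain ⟨g, -, rfl⟩ := mem_idealSubspace.1 (hc f hf)
    exact g.2
  have hmX : ∀ f ∈ idealSubspace (IsLocalRing.maximalIdeal A), (X : k⟦X⟧) ∣ f := by
    rintro _ ⟨f, hf, rfl⟩
    exact X_dvd_iff.2 ((mem_maximalIdeal_iff hA f).1 hf)
  have hpos : ∀ i, 0 < a i := by
    intro i
    obtain ⟨f, hf, hw⟩ := (ha.2 ▸ Set.mem_range_self (f := a) i :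
      a i ∈ valueSet (IsLocalRing.maximalIdeal A) \ _).1
    refine Nat.pos_of_ne_zero fun h0 => ?_
    rw [h0] at hw
    exact coeff_ne_zero_of_order hw (by simpa using (mem_maximalIdeal_iff hA f).1 hf)
  have hxX : ∀ i, (X : k⟦X⟧) ∣ x i := fun i =>
    (dvd_pow_self X (hpos i).ne').trans (X_pow_dvd_of_order (hx i))
  have hxm : ∀ i, (x i : k⟦X⟧) ∈ idealSubspace (IsLocalRing.maximalIdeal A) := fun i =>
    coe_mem_idealSubspace.2 ((mem_maximalIdeal_iff hA _).2 (X_dvd_iff.1 (hxX i)))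
  have hsubst : MvPowerSeries.HasSubst (fun i => ((x i : k⟦X⟧) : MvPowerSeries Unit k)) := by
    refine MvPowerSeries.hasSubst_of_constantCoeff_zero fun i => ?_
    exact X_dvd_iff.1 (hxX i)
  set M := idealSubspace (IsLocalRing.maximalIdeal A) with hMdef
  set B := (evalHom hsubst).range with hBdef
  have hxB : ∀ i, (x i : k⟦X⟧) ∈ B := fun i => ⟨MvPowerSeries.X i, evalHom_X hsubst i⟩
  let P : Submodule k k⟦X⟧ := Submodule.span k (Set.range fun i => (x i : k⟦X⟧))
  have hPM : P ≤ M := Submodule.span_le.2 (Set.range_subset_iff.2 hxm)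
  have hPB : ∀ j, P ^ j ≤ Subalgebra.toSubmodule B := by
    intro j
    induction j with
    | zero => exact pow_zero P ▸ Submodule.one_le.2 B.one_mem
    | succ j ih =>
      rw [pow_succ]
      refine Submodule.mul_le.2 fun p hp q hq => B.mul_mem (ih hp) ?_
      exact (Submodule.span_le (p := Subalgebra.toSubmodule B)).2 (Set.range_subset_iff.2 hxB) hq
  -- Every value of the maximal ideal is either attained in its square or is some a i, attained by x
  -- i.
  have hM : M ≤ P ⊔ M * M := by
    refine le_trans ?_ (sup_le_sup_left (idealSubspace_sq_le _) P)
    refine submodule_le_of_values c (fun f _ hf => Submodule.mem_sup_right (hc f hf)) ?_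
    intro f hf w _ hw
    by_cases hw2 : w ∈ valueSet (IsLocalRing.maximalIdeal A ^ 2)
    · obtain ⟨g, hg, hgw⟩ := hw2
      refine ⟨g, Submodule.mem_sup_right (coe_mem_idealSubspace.2 hg), ?_, hgw⟩
      exact coe_mem_idealSubspace.2 (Ideal.pow_le_self two_ne_zero hg)
    · obtain ⟨i, rfl⟩ : w ∈ Set.range a := ha.2 ▸ ⟨mem_valueSet_iff.2 ⟨f, hf, hw⟩, hw2⟩
      exact ⟨x i, Submodule.mem_sup_left (Submodule.subset_span ⟨i, rfl⟩), hxm i, hx i⟩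
  have hdense : ∀ j, ∀ f ∈ A, ∃ g ∈ B, (X : k⟦X⟧) ^ j ∣ f - g := by
    have h1 : ∀ j, M ≤ Subalgebra.toSubmodule B ⊔ M ^ (j + 1) := by
      intro j
      induction j with
      | zero => simp
      | succ j ih =>
        refine ih.trans (sup_le le_sup_left ((pow_le_pow_sup_pow hPM hM j).trans ?_))
        exact sup_le_sup_right (hPB _) _
    intro j f hf
    have h2 : f - C (constantCoeff f) ∈ M := by
      have hC : C (constantCoeff f) ∈ A := A.algebraMap_mem (constantCoeff f)
      refine ⟨⟨_, A.sub_mem hf hC⟩, (mem_maximalIdeal_iff hA _).2 ?_, rfl⟩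
      simp
    obtain ⟨g, hg, z, hz, hgz⟩ := Submodule.mem_sup.1 (h1 j h2)
    refine ⟨g + C (constantCoeff f), B.add_mem hg (B.algebraMap_mem (constantCoeff f)), ?_⟩
    have h3 : f - (g + C (constantCoeff f)) = z := by
      rw [add_comm, ← sub_sub, ← hgz, add_sub_cancel_left]
    exact h3 ▸ (pow_dvd_pow _ j.le_succ).trans (X_pow_dvd_of_mem_pow hmX _ z hz)
  have hcB : ∀ f, (X : k⟦X⟧) ^ c ∣ f → f ∈ B := by
    intro f hf
    have hg : ∀ r, ∃ g ∈ B, g.order = (c + r : ℕ) := by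
      intro r
      -- Precision c + r + 1 retains the leading term of t^(c + r).
      obtain ⟨g, hg, hd⟩ := hdense (c + r + 1) (X ^ (c + r)) (hcA _ (pow_dvd_pow _ (by omega)))
      refine ⟨g, hg, ?_⟩
      have hco : ∀ i < c + r + 1, coeff i g = coeff i (X ^ (c + r) : k⟦X⟧) := by
        intro i hi
        have := X_pow_dvd_iff.1 hd i hi
        rw [map_sub, sub_eq_zero] at this
        exact this.symm
      rw [order_eq_nat]
      refine ⟨by simp [hco], fun i hi => ?_⟩
      rw [hco i (by omega), coeff_X_pow, if_neg hi.ne]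
    choose g hgB hg using hg
    obtain ⟨γ, hγ⟩ := exists_expansion (hpos ⟨0, hn⟩) (hx ⟨0, hn⟩) g (fun r _ => hg r) hf
    choose L hLB hL using fun r => exists_mem_range_evalHom hsubst ⟨0, hn⟩ (γ r)
    rw [hγ L fun r Q => (pow_dvd_pow_of_dvd (hxX _) Q).trans (hL r Q)]
    exact B.sum_mem fun r _ => B.mul_mem (hLB r) (hgB r)
  refine ⟨hsubst, fun f => ⟨fun hf => ?_, ?_⟩⟩
  · obtain ⟨g, hg, hd⟩ := hdense c f hf
    have : f ∈ B := by
      have := B.add_mem (hcB _ hd) hg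
      rwa [sub_add_cancel] at this
    obtain ⟨F, hF⟩ := this
    exact ⟨F, (evalHom_apply hsubst F).symm.trans hF⟩
  · rintro ⟨F, rfl⟩
    exact evalHom_apply hsubst F ▸ evalHom_mem hsubst hxX (fun i => (x i).2) hcA F

end

/-! ### Assembly -/

theorem lt_lastIndexBelow_iff {n : ℕ} {a : Fin n → ℕ} (ha : StrictMono a) (hn : 0 < n) {c : ℕ}
    (i : Fin n) : (i : ℕ) < lastIndexBelow a hn c ↔ a i + a ⟨0, hn⟩ < c := by
  rw [lastIndexBelow, Finset.lt_sup_iff]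
  refine ⟨fun ⟨j, hj, hij⟩ => ?_, fun h => ⟨i, by simpa using h, Nat.lt_succ_self _⟩⟩
  have h1 : a i ≤ a j := ha.monotone (Fin.le_def.2 (Nat.lt_succ_iff.1 hij))
  have h2 := (Finset.mem_filter.1 hj).2
  omega

theorem lastIndexBelow_le {n : ℕ} (a : Fin n → ℕ) (hn : 0 < n) (c : ℕ) :
    lastIndexBelow a hn c ≤ n :=
  Finset.sup_le fun i _ => i.2

end HerzogKunz

end

theorem mainTheorem11 {k : Type*} [Field k] [IsAlgClosed k] [CharZero k]
    -- `R` is a complete local noetherian domain of dimension one with residue field `k`,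
    -- field of fractions `k⸨X⸩` and normalization `k⟦X⟧`
    (R : Subalgebra k k⟦X⟧) [IsLocalRing R] [IsNoetherianRing R]
    [IsAdicComplete (IsLocalRing.maximalIdeal R) R]
    (hdim : ringKrullDim R = 1)
    (hres : Function.Bijective (algebraMap k (IsLocalRing.ResidueField R)))
    [IsFractionRing R k⸨X⸩] [IsIntegralClosure k⟦X⟧ R k⸨X⸩]
    -- the Herzog--Kunz sequence of `R`, and Herzog--Kunz generators
    {n : ℕ} (hn : 0 < n) (a : Fin n → ℕ) (ha : HerzogKunz.IsHKSequence R a)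
    (x : Fin n → R) (hx : HerzogKunz.IsHKGenerators a x)
    (hcond : HerzogKunz.conductorIdeal R ≤ IsLocalRing.maximalIdeal R ^ 2)
    -- the gaps of the valuation semigroup in `[c - a₁, c - 1]`
    {s : ℕ} (b : Fin s → ℕ) (hb : StrictMono b)
    (hb_range : Set.range b =
      {w | HerzogKunz.conductorDegree R ≤ w + a ⟨0, hn⟩ ∧ w < HerzogKunz.conductorDegree R ∧
        w ∉ HerzogKunz.valueSemigroup R})
    (i₀ : ℕ) (hi₀ : i₀ = HerzogKunz.lastIndexBelow a hn (HerzogKunz.conductorDegree R))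
    (S : Subalgebra k k⟦X⟧) (hS : S = HerzogKunz.conductorExtension R (x ⟨0, hn⟩)) :
    s = HerzogKunz.reducedType R (x ⟨0, hn⟩) ∧
    ∃ (_ : IsLocalRing S) (a' : Fin (n + s) → ℕ),
      HerzogKunz.IsHKSequence S a' ∧
      a' '' {j | i₀ ≤ (j : ℕ)} = a '' {j | i₀ ≤ (j : ℕ)} ∪ Set.range b ∧
      ∃ x' : Fin (n + s) → S,
        HerzogKunz.IsHKGenerators a' x' ∧
        HerzogKunz.IsParametrization S x' ∧
        (∀ j : Fin n, (j : ℕ) < i₀ → (x' (Fin.castAdd s j) : k⟦X⟧) = x j) ∧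
        (∀ j : Fin (n + s), i₀ ≤ (j : ℕ) → (x' j : k⟦X⟧) = PowerSeries.X ^ a' j) := by
  open HerzogKunz PowerSeries in
  have hR := inv_mem_of_isIntegralClosure R
  have he := X_pow_dvd_of_mem_maximalIdeal hR hn ha
  obtain ⟨y, hym, hye⟩ := (ha.2.subset (Set.mem_range_self (⟨0, hn⟩ : Fin n))).1
  have hC := exists_order_eq_of_mem_conductorIdeal R
    (fun f hf => X_dvd_iff.2 ((mem_maximalIdeal_iff hR f).1 hf)) hym hye
  have he0 : 0 < a ⟨0, hn⟩ := by
    refine Nat.pos_of_ne_zero fun h0 => ?_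
    rw [h0] at hye
    exact coeff_ne_zero_of_order hye (by simpa using (mem_maximalIdeal_iff hR y).1 hym)
  have hcm : ∀ f : k⟦X⟧, (X : k⟦X⟧) ^ conductorDegree R ∣ f →
      f ∈ idealSubspace (IsLocalRing.maximalIdeal R ^ 2) := fun f hf =>
    ⟨⟨f, mem_of_X_pow_conductorDegree_dvd hC hf⟩,
      hcond ((mem_conductorIdeal_iff hC _).2 hf), rfl⟩
  -- t^c lies in 𝔪², all of whose elements have value at least 2a₁.
  have h2e : a ⟨0, hn⟩ * 2 ≤ conductorDegree R := by
    obtain ⟨g, hg, hgX⟩ := mem_idealSubspace.1 (hcm _ dvd_rfl)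
    have := le_order_iff_X_pow_dvd.2 (hgX ▸ X_pow_mul_dvd_of_mem_pow he 2 hg)
    rwa [order_X_pow, Nat.cast_le] at this
  obtain ⟨d, hd⟩ : ∃ d, conductorDegree R = a ⟨0, hn⟩ + d := Nat.exists_eq_add_of_le (by omega)
  have hed : a ⟨0, hn⟩ ≤ d := by omega
  have hd0 : 0 < d := by omega
  have hbR : Set.range b = {w | d ≤ w ∧ w < a ⟨0, hn⟩ + d ∧ w ∉ valueSemigroup R} := by
    rw [hb_range, hd]
    ext w
    refine and_congr_left fun _ => ?_
    omega
  have hbi : ∀ i, d ≤ b i ∧ b i < a ⟨0, hn⟩ + d ∧ b i ∉ valueSemigroup R := fun i =>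
    hbR.subset (Set.mem_range_self i)
  rw [hd] at hcm
  refine ⟨(reducedType_eq hC (hx _) hd hb.injective hbR).symm, ?_⟩
  have hSmem : ∀ f, f ∈ S ↔ ∃ r ∈ R, (X : k⟦X⟧) ^ d ∣ f - r :=
    hS ▸ mem_conductorExtension_iff hC (hx _) hd
  have hSinv := inv_mem_of_mem_iff hd0 hSmem hR
  have hSloc := isLocalRing_of_inv_mem hSinv
  have hab : Disjoint (Set.range a) (Set.range b) := by
    rw [Set.disjoint_left]
    rintro _ hw ⟨i, rfl⟩
    obtain ⟨f, -, hf⟩ := (ha.2.subset hw).1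
    exact (hbi i).2.2 ⟨f, trivial, hf⟩
  have hi : ∀ i : Fin n, (i : ℕ) < i₀ ↔ a i < d := by
    intro i
    rw [hi₀, lt_lastIndexBelow_iff ha.1, hd]
    omega
  obtain ⟨a', ha', hrange, himage, hlow⟩ := exists_strictMono_insert ha.1 hb.injective hab
    (fun i => (hbi i).1) (hi₀ ▸ lastIndexBelow_le a hn _) hi
  have hHK : IsHKSequence S a' := by
    refine ⟨ha', ?_⟩
    rw [hrange, valueSet_maximalIdeal_sdiff_eq hd0 hSmem hR he hed hcm, ← hbR, ha.2]
  have hhigh : ∀ j : Fin (n + s), i₀ ≤ (j : ℕ) → d ≤ a' j := by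
    intro j hj
    rcases himage.subset ⟨j, hj, rfl⟩ with ⟨i, hi', h⟩ | ⟨i, h⟩
    · exact h ▸ not_lt.1 fun hlt => not_lt.2 hi' ((hi i).2 hlt)
    · exact h ▸ (hbi i).1
  have hgen : ∀ j : Fin (n + s), ∃ z : S, (z : k⟦X⟧).order = a' j ∧
      (∀ i : Fin n, (i : ℕ) < i₀ → j = Fin.castAdd s i → (z : k⟦X⟧) = x i) ∧
      (i₀ ≤ (j : ℕ) → (z : k⟦X⟧) = X ^ a' j) := by
    intro j
    by_cases hj : (j : ℕ) < i₀
    · have hjn : (j : ℕ) < n := hj.trans_le (hi₀ ▸ lastIndexBelow_le a hn _)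
      have hji : j = Fin.castAdd s ⟨j, hjn⟩ := rfl
      refine ⟨⟨x ⟨j, hjn⟩, (hSmem _).2 ⟨_, (x ⟨j, hjn⟩).2, by simp⟩⟩, ?_, ?_, fun h => by omega⟩
      · exact (hx _).trans (congrArg _ (hlow ⟨j, hjn⟩ hj).symm)
      · rintro i - rfl
        rfl
    · refine ⟨⟨X ^ a' j, (hSmem _).2 ⟨0, R.zero_mem, ?_⟩⟩, order_X_pow _, ?_, fun _ => rfl⟩
      · simpa using pow_dvd_pow _ (hhigh j (not_lt.1 hj))
      · rintro i hi' rfl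
        exact absurd hi' hj
  choose x' hx' hx'low hx'high using hgen
  refine ⟨hSloc, a', hHK, himage, x', hx', ?_, fun j hj => hx'low _ j hj rfl, hx'high⟩
  -- The parametrization criterion applies to S because 𝔪_S² = 𝔪² still contains t^c k⟦t⟧.
  have hcS : ∀ f : k⟦X⟧, (X : k⟦X⟧) ^ (a ⟨0, hn⟩ + d) ∣ f →
      f ∈ idealSubspace (IsLocalRing.maximalIdeal S ^ 2) := by
    rw [idealSubspace_maximalIdeal_sq_eq hd0 hSmem hR he hed hcm]
    exact hcm
  exact isParametrization_of_isHKGenerators hSinv hcS (by omega) hHK hx'
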